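/- Let $n\ge 1$ and let $\mathcal{S}_n$ be the real vector space of real symmetric $n\times n$ matrices. A matrix $A\in\mathcal{S}_n$ is called strictly copositive if $x^TAx>0$ for every nonzero vector $x\in\mathbb{R}^n$ with nonnegative entries; let $\mathrm{SCOP}_n\subseteq\mathcal{S}_n$ be the set of all such matrices. A square matrix is called monomial if it has exactly one nonzero entry in each row and in each column. Let $\mathcal{L}:\mathcal{S}_n\to\mathcal{S}_n$ be a linear map. Then $\mathcal{L}(\mathrm{SCOP}_n)=\mathrm{SCOP}_n$ if and only if there is a monomial matrix $Q\in\mathbb{R}^{n\times n}$ with nonnegative entries such that $\mathcal{L}(A)=QAQ^T$ for all $A\in\mathcal{S}_n$. -/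

import Mathlib

open scoped Matrix

/-- The real vector space of `n × n` real symmetric matrices. -/
def SymMat (n : ℕ) : Submodule ℝ (Matrix (Fin n) (Fin n) ℝ) where
  carrier := {A | A.IsSymm}
  add_mem' hA hB := Matrix.IsSymm.add hA hB
  zero_mem' := Matrix.isSymm_zero
  smul_mem' c _ hA := Matrix.IsSymm.smul hA c

/-- The set of strictly copositive matrices: real symmetric matrices `A` with `xᵀ A x > 0` for
every nonzero vector `x` with nonnegative entries. -/
def SCOP (n : ℕ) : Set (SymMat n) :=
  {A | ∀ x : Fin n → ℝ, (∀ i, 0 ≤ x i) → x ≠ 0 →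
    0 < x ⬝ᵥ ((A : Matrix (Fin n) (Fin n) ℝ) *ᵥ x)}

/-- A monomial matrix: exactly one nonzero entry in each row and in each column. -/
def IsMonomialMatrix {n : ℕ} (Q : Matrix (Fin n) (Fin n) ℝ) : Prop :=
  (∀ i, ∃! j, Q i j ≠ 0) ∧ (∀ j, ∃! i, Q i j ≠ 0)

/-- An entrywise nonnegative matrix. -/
def IsNonnegMatrix {n : ℕ} (Q : Matrix (Fin n) (Fin n) ℝ) : Prop :=
  ∀ i j, 0 ≤ Q i j

/-! Strictly copositive matrices span, so a preserver `L` is bijective. For nonzero `x ≥ 0` the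
matrix `|x|² I - x xᵀ` is positive semidefinite but not strictly copositive, hence neither is its
preimage: some nonzero `y ≥ 0` makes `A ↦ yᵀ L⁻¹(A) y` vanish on it. This functional is nonnegative
on semidefinite matrices, so it is a multiple of `A ↦ xᵀ A x` (`functional_eq_evalForm`). After
rescaling, `xᵀ L(A) x = yᵀ A y` (`exists_evalForm_comp_eq`). Taking `x = eᵢ` gives the rows of `Q ≥
0` and the diagonal of `L(A) = Q A Qᵀ`. Off the diagonal, `x = eᵢ + t eⱼ` gives a quadratic pencil
of rank-one matrices, whose root is `±(q + t p)` or `±(q - t p)`; nonnegativity excludes the second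
(`rankOne_pencil`). The same argument for `L⁻¹` gives `R ≥ 0` with `Q R = 1`, and a nonnegative
matrix with nonnegative inverse is monomial. -/

/-- The identity matrix as an element of `SymMat n`. -/
def symOne (n : ℕ) : SymMat n := ⟨1, Matrix.isSymm_one⟩

/-- The symmetric matrix `v wᵀ + w vᵀ`. -/
def symProd {n : ℕ} (v w : Fin n → ℝ) : SymMat n :=
  ⟨Matrix.vecMulVec v w + Matrix.vecMulVec w v, by
    change (_ : Matrix _ _ ℝ)ᵀ = _
    rw [Matrix.transpose_add, Matrix.transpose_vecMulVec, Matrix.transpose_vecMulVec, add_comm]⟩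

/-- The symmetric matrix `v vᵀ`. -/
def rankOne {n : ℕ} (v : Fin n → ℝ) : SymMat n :=
  ⟨Matrix.vecMulVec v v, Matrix.transpose_vecMulVec v v⟩

/-- The linear functional `A ↦ xᵀ A y`. -/
def evalForm {n : ℕ} (x y : Fin n → ℝ) : SymMat n →ₗ[ℝ] ℝ where
  toFun A := x ⬝ᵥ ((A : Matrix (Fin n) (Fin n) ℝ) *ᵥ y)
  map_add' A B := by simp [Matrix.add_mulVec, dotProduct_add]
  map_smul' c A := by simp [Matrix.smul_mulVec, dotProduct_smul]

/-- The set of copositive matrices. -/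
def COP (n : ℕ) : Set (SymMat n) :=
  {A | ∀ x : Fin n → ℝ, (∀ i, 0 ≤ x i) → 0 ≤ evalForm x x A}

/-! ### Bilinear evaluations and spanning sets of symmetric matrices -/

section forms

variable {n : ℕ}

lemma evalForm_apply (x y : Fin n → ℝ) (A : SymMat n) :
    evalForm x y A = x ⬝ᵥ ((A : Matrix (Fin n) (Fin n) ℝ) *ᵥ y) := rfl

lemma evalForm_add_left (x y z : Fin n → ℝ) (A : SymMat n) :
    evalForm (x + y) z A = evalForm x z A + evalForm y z A := by
  simp [evalForm_apply, add_dotProduct]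

lemma evalForm_add_right (x y z : Fin n → ℝ) (A : SymMat n) :
    evalForm x (y + z) A = evalForm x y A + evalForm x z A := by
  simp [evalForm_apply, Matrix.mulVec_add, dotProduct_add]

lemma evalForm_smul_left (c : ℝ) (x y : Fin n → ℝ) (A : SymMat n) :
    evalForm (c • x) y A = c * evalForm x y A := by
  simp [evalForm_apply]

lemma evalForm_smul_right (c : ℝ) (x y : Fin n → ℝ) (A : SymMat n) :
    evalForm x (c • y) A = c * evalForm x y A := by
  simp [evalForm_apply, Matrix.mulVec_smul]

lemma evalForm_comm (x y : Fin n → ℝ) (A : SymMat n) : evalForm x y A = evalForm y x A := by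
  have hA : (A : Matrix (Fin n) (Fin n) ℝ)ᵀ = A := A.2
  rw [evalForm_apply, evalForm_apply, Matrix.dotProduct_mulVec, ← Matrix.mulVec_transpose, hA,
    dotProduct_comm]

lemma evalForm_single (i j : Fin n) (A : SymMat n) :
    evalForm (Pi.single i 1) (Pi.single j 1) A = (A : Matrix (Fin n) (Fin n) ℝ) i j := by
  simp [evalForm_apply]

lemma evalForm_symOne (x y : Fin n → ℝ) : evalForm x y (symOne n) = x ⬝ᵥ y := by
  simp [evalForm_apply, symOne]

lemma evalForm_rankOne (x y v : Fin n → ℝ) :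
    evalForm x y (rankOne v) = (v ⬝ᵥ x) * (v ⬝ᵥ y) := by
  simp [evalForm_apply, rankOne, Matrix.vecMulVec_mulVec, dotProduct_comm x v, mul_comm]

lemma evalForm_symProd (x v w : Fin n → ℝ) :
    evalForm x x (symProd v w) = 2 * ((v ⬝ᵥ x) * (w ⬝ᵥ x)) := by
  simp only [evalForm_apply, symProd, Matrix.add_mulVec, Matrix.vecMulVec_mulVec, dotProduct_add,
    dotProduct_comm x v, dotProduct_comm x w, dotProduct_smul, MulOpposite.smul_eq_mul_unop,
    MulOpposite.unop_op]
  ring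

lemma rankOne_add (v w : Fin n → ℝ) :
    rankOne (v + w) = rankOne v + symProd v w + rankOne w := by
  ext i j
  simp [rankOne, symProd, Matrix.vecMulVec_apply]
  ring

lemma rankOne_smul (c : ℝ) (v : Fin n → ℝ) : rankOne (c • v) = c ^ 2 • rankOne v := by
  ext i j
  simp [rankOne, Matrix.vecMulVec_apply]
  ring

lemma symProd_smul (c d : ℝ) (v w : Fin n → ℝ) :
    symProd (c • v) (d • w) = (c * d) • symProd v w := by
  ext i j
  simp [symProd, Matrix.vecMulVec_apply]
  ring

lemma span_range_rankOne : Submodule.span ℝ (Set.range (rankOne (n := n))) = ⊤ := by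
  refine eq_top_iff.2 fun A _ => ?_
  have hA : A = (1 / 2 : ℝ) • ∑ i, ∑ j, (A : Matrix (Fin n) (Fin n) ℝ) i j •
      symProd (Pi.single i 1) (Pi.single j 1) := by
    ext a b
    have hs : (A : Matrix (Fin n) (Fin n) ℝ) b a = (A : Matrix (Fin n) (Fin n) ℝ) a b :=
      A.2.apply a b
    simp [symProd, Matrix.vecMulVec_apply, Matrix.sum_apply, mul_add, Finset.sum_add_distrib,
      Pi.single_apply, hs]
    ring
  rw [hA]
  refine Submodule.smul_mem _ _ (Submodule.sum_mem _ fun i _ => Submodule.sum_mem _ fun j _ =>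
    Submodule.smul_mem _ _ ?_)
  have h := rankOne_add (Pi.single i (1 : ℝ)) (Pi.single j (1 : ℝ) : Fin n → ℝ)
  have h' : symProd (Pi.single i (1 : ℝ)) (Pi.single j (1 : ℝ) : Fin n → ℝ) =
      rankOne (Pi.single i 1 + Pi.single j 1) - rankOne (Pi.single i 1)
        - rankOne (Pi.single j 1) := by
    rw [h]; abel
  rw [h']
  exact Submodule.sub_mem _ (Submodule.sub_mem _ (Submodule.subset_span ⟨_, rfl⟩)
    (Submodule.subset_span ⟨_, rfl⟩)) (Submodule.subset_span ⟨_, rfl⟩)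

lemma mem_SCOP_iff {A : SymMat n} :
    A ∈ SCOP n ↔ ∀ x : Fin n → ℝ, (∀ i, 0 ≤ x i) → x ≠ 0 → 0 < evalForm x x A := Iff.rfl

lemma dotProduct_self_pos {x : Fin n → ℝ} (hx : x ≠ 0) : 0 < x ⬝ᵥ x :=
  lt_of_le_of_ne (Finset.sum_nonneg fun i _ => mul_self_nonneg (x i))
    fun h => hx (dotProduct_self_eq_zero.1 h.symm)

lemma symOne_mem_SCOP : symOne n ∈ SCOP n := fun x _ hx => by
  have := evalForm_symOne x x
  rw [evalForm_apply] at this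
  rw [this]
  exact dotProduct_self_pos hx

lemma symOne_add_rankOne_mem_SCOP (w : Fin n → ℝ) : symOne n + rankOne w ∈ SCOP n := by
  rw [mem_SCOP_iff]
  intro x _ hx
  rw [map_add, evalForm_symOne, evalForm_rankOne]
  have := dotProduct_self_pos hx
  nlinarith [mul_self_nonneg (w ⬝ᵥ x)]

/-- Each `w wᵀ` is the difference of the strictly copositive matrices `I + w wᵀ` and `I`. -/
lemma span_SCOP : Submodule.span ℝ (SCOP n) = ⊤ := by
  rw [eq_top_iff, ← span_range_rankOne, Submodule.span_le]
  rintro _ ⟨w, rfl⟩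
  have : rankOne w = (symOne n + rankOne w) - symOne n := by abel
  rw [this]
  exact Submodule.sub_mem _ (Submodule.subset_span (symOne_add_rankOne_mem_SCOP w))
    (Submodule.subset_span symOne_mem_SCOP)

end forms

/-! ### Pulling back the evaluations `A ↦ xᵀ A x` -/

section functionals

variable {n : ℕ}

/-- A functional that is nonnegative on positive semidefinite matrices and vanishes on
`|x|² I - x xᵀ` is a multiple of `A ↦ xᵀ A x`. -/
lemma functional_eq_evalForm {g : SymMat n →ₗ[ℝ] ℝ}
    (hg : ∀ A, (∀ z, 0 ≤ evalForm z z A) → 0 ≤ g A) {x : Fin n → ℝ} (hx : x ≠ 0)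
    (h0 : g ((x ⬝ᵥ x) • symOne n - rankOne x) = 0) (A : SymMat n) :
    (x ⬝ᵥ x) ^ 2 * g A = g (rankOne x) * evalForm x x A := by
  have hxx := dotProduct_self_pos hx
  have hr : ∀ v, 0 ≤ g (rankOne v) := fun v => hg _ fun z => by
    rw [evalForm_rankOne]; exact mul_self_nonneg _
  have hperp : ∀ v, x ⬝ᵥ v = 0 → g (rankOne v) = 0 := by
    intro v hv
    -- For `v ⊥ x` this matrix is semidefinite by Bessel's inequality; since `g` kills its first
    -- term, `g (v vᵀ) ≤ 0`.
    have h1 : 0 ≤ g ((v ⬝ᵥ v) • ((x ⬝ᵥ x) • symOne n - rankOne x) - (x ⬝ᵥ x) • rankOne v) := by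
      apply hg
      intro z
      simp only [map_sub, map_smul, evalForm_symOne, evalForm_rankOne, smul_eq_mul]
      have hvx : v ⬝ᵥ x = 0 := by rw [dotProduct_comm, hv]
      by_cases hv0 : v = 0
      · simp [hv0]
      have hvv := dotProduct_self_pos hv0
      set X := x ⬝ᵥ x
      set V := v ⬝ᵥ v
      -- Squared norm of the component of `z` orthogonal to `x` and `v`, with denominators cleared.
      have h2 : 0 ≤ ((X * V) • z - (V * (x ⬝ᵥ z)) • x - (X * (v ⬝ᵥ z)) • v) ⬝ᵥ
          ((X * V) • z - (V * (x ⬝ᵥ z)) • x - (X * (v ⬝ᵥ z)) • v) :=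
        Finset.sum_nonneg fun i _ => mul_self_nonneg _
      simp only [sub_dotProduct, dotProduct_sub, smul_dotProduct, dotProduct_smul, smul_eq_mul,
        hv, hvx, dotProduct_comm z x, dotProduct_comm z v] at h2
      have h3 : 0 ≤ (X * V) * (V * (X * (z ⬝ᵥ z) - (x ⬝ᵥ z) * (x ⬝ᵥ z))
          - X * ((v ⬝ᵥ z) * (v ⬝ᵥ z))) := by
        convert h2 using 1
        simp only [X, V]
        ring
      exact nonneg_of_mul_nonneg_right h3 (mul_pos hxx hvv)
    rw [map_sub, map_smul, h0, map_smul, smul_zero, zero_sub, smul_eq_mul] at h1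
    have h2 := hr v
    nlinarith
  have hmix : ∀ v, x ⬝ᵥ v = 0 → g (symProd x v) = 0 := by
    intro v hv
    -- An affine function of `t` bounded below on all of `ℝ` has zero slope.
    have h1 : ∀ t : ℝ, 0 ≤ g (rankOne x) + t * g (symProd x v) := fun t => by
      have h2 := hr (x + t • v)
      have h3 := symProd_smul 1 t x v
      rw [one_smul, one_mul] at h3
      rwa [rankOne_add, rankOne_smul, h3, map_add, map_add, map_smul, map_smul, hperp v hv,
        smul_zero, add_zero, smul_eq_mul] at h2
    by_contra hne
    have h2 := h1 (-(g (rankOne x) + 1) / g (symProd x v))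
    rw [div_mul_cancel₀ _ hne] at h2
    linarith
  have key : (x ⬝ᵥ x) ^ 2 • g = g (rankOne x) • evalForm x x := by
    refine LinearMap.ext_on_range span_range_rankOne fun w => ?_
    -- The component of `w` orthogonal to `x`, scaled by `|x|²`.
    set v := (x ⬝ᵥ x) • w - (x ⬝ᵥ w) • x with hv
    have hxv : x ⬝ᵥ v = 0 := by
      rw [hv, dotProduct_sub, dotProduct_smul, dotProduct_smul, smul_eq_mul, smul_eq_mul,
        mul_comm, sub_self]
    have hw : (x ⬝ᵥ x) • w = (x ⬝ᵥ w) • x + v := by rw [hv]; abel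
    have h3 := symProd_smul (x ⬝ᵥ w) 1 x v
    rw [one_smul, mul_one] at h3
    have h4 := congrArg (fun u => g (rankOne u)) hw
    simp only [rankOne_add, rankOne_smul, h3, map_add, map_smul, hperp v hxv, hmix v hxv,
      smul_eq_mul] at h4
    rw [mul_zero, add_zero, add_zero] at h4
    rw [LinearMap.smul_apply, LinearMap.smul_apply, evalForm_rankOne, smul_eq_mul, smul_eq_mul,
      h4, dotProduct_comm w x, sq, mul_comm]
  have := congrArg (fun f => f A) key
  simpa using this

lemma mem_COP_of_forall_mem_SCOP {A B : SymMat n}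
    (h : ∀ ε : ℝ, 0 < ε → A + ε • B ∈ SCOP n) : A ∈ COP n := by
  intro x hx
  by_cases hx0 : x = 0
  · simp [hx0, evalForm_apply]
  refine le_of_forall_pos_lt_add fun δ hδ => ?_
  have h1 : ∀ ε : ℝ, 0 < ε → 0 < evalForm x x A + ε * evalForm x x B := fun ε hε => by
    have := mem_SCOP_iff.1 (h ε hε) x hx hx0
    simpa using this
  have hb : 0 < |evalForm x x B| + 1 := by positivity
  have h2 := h1 (δ / (|evalForm x x B| + 1)) (by positivity)
  have h3 : δ / (|evalForm x x B| + 1) * evalForm x x B ≤ δ := by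
    rw [div_mul_eq_mul_div, div_le_iff₀ hb]
    nlinarith [le_abs_self (evalForm x x B)]
  linarith

/-- Copositive matrices are limits of strictly copositive ones: perturb by `ε I` and let `ε` tend to
0. -/
lemma map_mem_COP {e : SymMat n →ₗ[ℝ] SymMat n} (he : ∀ A ∈ SCOP n, e A ∈ SCOP n)
    {A : SymMat n} (hA : A ∈ COP n) : e A ∈ COP n := by
  refine mem_COP_of_forall_mem_SCOP (B := e (symOne n)) fun ε hε => ?_
  rw [← map_smul, ← map_add]
  refine he _ (mem_SCOP_iff.2 fun x hx hx0 => ?_)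
  have h1 := hA x hx
  have h2 := mul_pos hε (dotProduct_self_pos hx0)
  rw [map_add, map_smul, evalForm_symOne, smul_eq_mul]
  linarith

lemma exists_evalForm_comp_eq {e : SymMat n ≃ₗ[ℝ] SymMat n}
    (he : ∀ A, e A ∈ SCOP n ↔ A ∈ SCOP n) {x : Fin n → ℝ} (hx : ∀ i, 0 ≤ x i) (hx0 : x ≠ 0) :
    ∃ y : Fin n → ℝ, (∀ i, 0 ≤ y i) ∧ ∀ A, evalForm x x (e A) = evalForm y y A := by
  have hsymm : ∀ A ∈ SCOP n, e.symm A ∈ SCOP n := fun A hA => by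
    rw [← he, e.apply_symm_apply]; exact hA
  have hxx := dotProduct_self_pos hx0
  set A₀ := (x ⬝ᵥ x) • symOne n - rankOne x with hA₀
  have hA₀val : ∀ z, evalForm z z A₀ = (x ⬝ᵥ x) * (z ⬝ᵥ z) - (x ⬝ᵥ z) * (x ⬝ᵥ z) := fun z => by
    simp only [hA₀, map_sub, map_smul, evalForm_symOne, evalForm_rankOne, smul_eq_mul]
  have hA₀pos : ∀ z, 0 ≤ evalForm z z A₀ := fun z => by
    have h2 : 0 ≤ ((x ⬝ᵥ x) • z - (x ⬝ᵥ z) • x) ⬝ᵥ ((x ⬝ᵥ x) • z - (x ⬝ᵥ z) • x) :=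
      Finset.sum_nonneg fun i _ => mul_self_nonneg _
    simp only [sub_dotProduct, dotProduct_sub, smul_dotProduct, dotProduct_smul, smul_eq_mul,
      dotProduct_comm z x] at h2
    rw [hA₀val]
    refine nonneg_of_mul_nonneg_right (h2.trans_eq ?_) hxx
    ring
  have hnot : e.symm A₀ ∉ SCOP n := fun h => by
    rw [← he, e.apply_symm_apply] at h
    have := mem_SCOP_iff.1 h x hx hx0
    rw [hA₀val] at this
    simp at this
  rw [mem_SCOP_iff] at hnot
  push Not at hnot
  obtain ⟨y, hy, hy0, hyA⟩ := hnot
  have hcop : ∀ A ∈ COP n, e.symm A ∈ COP n := fun A hA =>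
    map_mem_COP (e := e.symm.toLinearMap) hsymm hA
  have key := functional_eq_evalForm (g := (evalForm y y).comp e.symm.toLinearMap)
    (fun A hA => hcop A (fun z _ => hA z) y hy) hx0
    (le_antisymm hyA (hcop A₀ (fun z _ => hA₀pos z) y hy))
  set k := ((evalForm y y).comp e.symm.toLinearMap) (rankOne x)
  have key' : ∀ A, (x ⬝ᵥ x) ^ 2 * evalForm y y A = k * evalForm x x (e A) := fun A => by
    have := key (e A)
    simpa using this
  have hk : 0 ≤ k := hcop _ (fun z _ => by rw [evalForm_rankOne]; exact mul_self_nonneg _) y hy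
  have hk0 : 0 < k := by
    refine lt_of_le_of_ne hk fun h => ?_
    have h1 := key' (symOne n)
    rw [← h, zero_mul, evalForm_symOne] at h1
    have := mul_pos (pow_pos hxx 2) (dotProduct_self_pos hy0)
    linarith
  -- The scaling that absorbs the constants in `|x|⁴ yᵀ A y = k xᵀ e(A) x`.
  refine ⟨((x ⬝ᵥ x) / √k) • y, fun i => mul_nonneg (div_nonneg hxx.le (Real.sqrt_nonneg _)) (hy i),
    fun A => ?_⟩
  have hs := Real.sq_sqrt hk
  rw [evalForm_smul_left, evalForm_smul_right, ← mul_assoc, ← sq, div_pow, hs,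
    div_mul_eq_mul_div, key', mul_div_cancel_left₀ _ hk0.ne']

end functionals

/-! ### Quadratic pencils of rank-one matrices -/

section pencil

variable {n : ℕ}

/-- A quadratic pencil `q qᵀ + t M + t² p pᵀ` of rank-one matrices `Y Yᵀ` with `Y ≥ 0` is
`(q + t p) (q + t p)ᵀ`, evaluated here at `t = 1`. -/
lemma rankOne_pencil {q p : Fin n → ℝ} (hq : ∀ i, 0 ≤ q i) (hp : ∀ i, 0 ≤ p i)
    {Y : ℝ → Fin n → ℝ} (hY : ∀ t, 0 < t → ∀ i, 0 ≤ Y t i) {m : (Fin n → ℝ) → (Fin n → ℝ) → ℝ}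
    (h : ∀ t, 0 < t → ∀ v w, (v ⬝ᵥ Y t) * (w ⬝ᵥ Y t) =
      (v ⬝ᵥ q) * (w ⬝ᵥ q) + t * m v w + t ^ 2 * ((v ⬝ᵥ p) * (w ⬝ᵥ p)))
    {a b : Fin n} (hab : q a * p b - q b * p a ≠ 0) :
    Y 1 = q + p ∨ Y 1 = -(q + p) := by
  -- `u` and `v` are dual to `q` and `p`, by Cramer's rule.
  obtain ⟨u, huq, hup⟩ : ∃ u : Fin n → ℝ, u ⬝ᵥ q = 1 ∧ u ⬝ᵥ p = 0 := by
    refine ⟨(q a * p b - q b * p a)⁻¹ • (p b • Pi.single a 1 - p a • Pi.single b 1), ?_, ?_⟩ <;>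
      simp only [smul_dotProduct, sub_dotProduct, single_one_dotProduct, smul_eq_mul]
    · rw [← inv_mul_cancel₀ hab]; ring
    · ring
  obtain ⟨v, hvq, hvp⟩ : ∃ v : Fin n → ℝ, v ⬝ᵥ q = 0 ∧ v ⬝ᵥ p = 1 := by
    refine ⟨(q a * p b - q b * p a)⁻¹ • (q a • Pi.single b 1 - q b • Pi.single a 1), ?_, ?_⟩ <;>
      simp only [smul_dotProduct, sub_dotProduct, single_one_dotProduct, smul_eq_mul]
    · ring
    · rw [← inv_mul_cancel₀ hab]
  have huu : ∀ t, 0 < t → (u ⬝ᵥ Y t) * (u ⬝ᵥ Y t) = 1 + t * m u u := fun t ht => by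
    rw [h t ht, huq, hup]; ring
  have hvv : ∀ t, 0 < t → (v ⬝ᵥ Y t) * (v ⬝ᵥ Y t) = t * m v v + t ^ 2 := fun t ht => by
    rw [h t ht, hvq, hvp]; ring
  have huv : ∀ t, 0 < t → (u ⬝ᵥ Y t) * (v ⬝ᵥ Y t) = t * m u v := fun t ht => by
    rw [h t ht, huq, hup, hvq, hvp]; ring
  -- A 2 × 2 minor of a rank-one matrix vanishes. Divided by `t`, this is a quadratic in `t`, so
  -- three values of `t` determine its coefficients.
  have hdet : ∀ t, 0 < t → (1 + t * m u u) * (t * m v v + t ^ 2) = (t * m u v) ^ 2 :=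
    fun t ht => by rw [← huu t ht, ← hvv t ht, ← huv t ht]; ring
  have hd1 := hdet 1 one_pos
  have hd2 := hdet 2 two_pos
  have hd3 := hdet 3 three_pos
  have hmu : m u u = 0 := by linarith
  have hmuv : m u v ^ 2 = 1 := by
    rw [hmu] at hd1 hd2
    linarith
  simp only [hmu, mul_zero, add_zero] at huu
  have hperp : ∀ w, w ⬝ᵥ q = 0 → w ⬝ᵥ p = 0 → ∀ t, 0 < t → w ⬝ᵥ Y t = 0 := by
    intro w hwq hwp
    have hww : ∀ t, 0 < t → (w ⬝ᵥ Y t) * (w ⬝ᵥ Y t) = t * m w w := fun t ht => by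
      rw [h t ht, hwq, hwp]; ring
    have huw : ∀ t, 0 < t → (u ⬝ᵥ Y t) * (w ⬝ᵥ Y t) = t * m u w := fun t ht => by
      rw [h t ht, hwq, hwp]; ring
    have hd : ∀ t, 0 < t → t * m w w = (t * m u w) ^ 2 := fun t ht => by
      rw [← huw t ht, ← hww t ht, mul_pow, sq (u ⬝ᵥ Y t), huu t ht]; ring
    have h1 := hd 1 one_pos
    have h2 := hd 2 two_pos
    have h0 : m w w = 0 := by linarith
    intro t ht
    have := hww t ht
    rw [h0, mul_zero] at this
    exact mul_self_eq_zero.1 this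
  have hYeq : ∀ t, 0 < t → ∀ c, Y t c = (u ⬝ᵥ Y t) * q c + (v ⬝ᵥ Y t) * p c := by
    intro t ht c
    have h1 := hperp (Pi.single c 1 - q c • u - p c • v)
      (by simp only [sub_dotProduct, smul_dotProduct, single_one_dotProduct, smul_eq_mul, huq, hvq]
          ring)
      (by simp only [sub_dotProduct, smul_dotProduct, single_one_dotProduct, smul_eq_mul, hup, hvp]
          ring) t ht
    simp only [sub_dotProduct, smul_dotProduct, single_one_dotProduct, smul_eq_mul] at h1
    linarith
  rcases mul_self_eq_one_iff.1 ((sq (m u v)).symm.trans hmuv) with hm | hm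
  · have hu1 := huu 1 one_pos
    have huv1 := huv 1 one_pos
    rw [hm, mul_one] at huv1
    rcases mul_self_eq_one_iff.1 hu1 with hu | hu
    · left
      ext c
      rw [hu, one_mul] at huv1
      rw [hYeq 1 one_pos, hu, huv1, one_mul, one_mul, Pi.add_apply]
    · right
      ext c
      rw [hu] at huv1
      have : v ⬝ᵥ Y 1 = -1 := by linarith
      rw [hYeq 1 one_pos, hu, this, Pi.neg_apply, Pi.add_apply]
      ring
  -- Here `Y t = ±(q - t p)`, so `(q a - t p a) (q b - t p b) ≥ 0` for all `t > 0`. This fails for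
  -- large `t` if `p a * p b = 0`, and otherwise at the vertex of the parabola.
  · exfalso
    have hprod : ∀ t, 0 < t → 0 ≤ q a * q b - t * (q a * p b + q b * p a) + t ^ 2 * (p a * p b) := by
      intro t ht
      have h1 := mul_nonneg (hY t ht a) (hY t ht b)
      rw [hYeq t ht a, hYeq t ht b] at h1
      have h2 := huu t ht
      have h3 := hvv t ht
      have h4 := huv t ht
      rw [hm] at h4
      have hmv : m v v = 0 := by
        rw [hmu] at hd1 hd2
        nlinarith
      rw [hmv] at h3
      have h5 : ((u ⬝ᵥ Y t) * q a + (v ⬝ᵥ Y t) * p a) * ((u ⬝ᵥ Y t) * q b + (v ⬝ᵥ Y t) * p b) =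
          ((u ⬝ᵥ Y t) * (u ⬝ᵥ Y t)) * (q a * q b)
            + ((u ⬝ᵥ Y t) * (v ⬝ᵥ Y t)) * (q a * p b + q b * p a)
            + ((v ⬝ᵥ Y t) * (v ⬝ᵥ Y t)) * (p a * p b) := by ring
      rw [h5, h2, h3, h4] at h1
      linarith
    have hβ : 0 < q a * p b + q b * p a := by
      have h1 := mul_nonneg (hq a) (hp b)
      have h2 := mul_nonneg (hq b) (hp a)
      refine lt_of_le_of_ne (add_nonneg h1 h2) fun h0 => hab ?_
      linarith
    have hγ := mul_nonneg (hq a) (hq b)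
    rcases (mul_nonneg (hp a) (hp b)).eq_or_lt with hα | hα
    · have h1 := hprod ((q a * q b + 1) / (q a * p b + q b * p a)) (by positivity)
      rw [div_mul_cancel₀ _ hβ.ne', ← hα] at h1
      linarith
    · have h1 := hprod ((q a * p b + q b * p a) / (2 * (p a * p b))) (by positivity)
      have h2 : 0 < (q a * p b - q b * p a) ^ 2 := by positivity
      have h3 : (4 * (p a * p b)) * (q a * q b -
          (q a * p b + q b * p a) / (2 * (p a * p b)) * (q a * p b + q b * p a) +
          ((q a * p b + q b * p a) / (2 * (p a * p b))) ^ 2 * (p a * p b)) =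
          -(q a * p b - q b * p a) ^ 2 := by
        have := hα.ne'
        generalize hβ' : q a * p b + q b * p a = β
        generalize hα' : p a * p b = α at this
        have : 4 * α * (q a * q b) - β ^ 2 = -(q a * p b - q b * p a) ^ 2 := by
          rw [← hα', ← hβ']; ring
        rw [← this]
        field_simp
        ring
      have h4 := mul_nonneg (mul_pos four_pos hα).le h1
      linarith

end pencil

/-! ### Conjugation form of preservers, and monomial matrices -/

section preservers

variable {n : ℕ}

lemma transpose_mulVec_nonneg {Q : Matrix (Fin n) (Fin n) ℝ} (hQ : IsNonnegMatrix Q)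
    {x : Fin n → ℝ} (hx : ∀ i, 0 ≤ x i) (i : Fin n) : 0 ≤ (Qᵀ *ᵥ x) i := by
  rw [Matrix.mulVec_eq_sum, Finset.sum_apply]
  exact Finset.sum_nonneg fun j _ => mul_nonneg (hQ j i) (hx j)

lemma dotProduct_conj_mulVec (Q A : Matrix (Fin n) (Fin n) ℝ) (x : Fin n → ℝ) :
    x ⬝ᵥ ((Q * A * Qᵀ) *ᵥ x) = (Qᵀ *ᵥ x) ⬝ᵥ (A *ᵥ (Qᵀ *ᵥ x)) := by
  rw [← Matrix.mulVec_mulVec, ← Matrix.mulVec_mulVec, Matrix.dotProduct_mulVec,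
    ← Matrix.mulVec_transpose]

lemma evalForm_single_eq {e : SymMat n ≃ₗ[ℝ] SymMat n}
    (he : ∀ A, e A ∈ SCOP n ↔ A ∈ SCOP n) {i j : Fin n} (hij : i ≠ j) {q p : Fin n → ℝ}
    (hq : ∀ i, 0 ≤ q i) (hp : ∀ i, 0 ≤ p i)
    (hqe : ∀ A, evalForm (Pi.single i 1) (Pi.single i 1) (e A) = evalForm q q A)
    (hpe : ∀ A, evalForm (Pi.single j 1) (Pi.single j 1) (e A) = evalForm p p A)
    (A : SymMat n) :
    evalForm (Pi.single i 1) (Pi.single j 1) (e A) = evalForm q p A := by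
  -- If `q` and `p` were parallel, the `(i,i)` and `(j,j)` entries of `e A` would be dependent,
  -- against surjectivity: test on the preimages of `eᵢ eᵢᵀ` and `eⱼ eⱼᵀ`.
  obtain ⟨a, b, hab⟩ : ∃ a b, q a * p b - q b * p a ≠ 0 := by
    by_contra! hcon
    have hpq : ∀ a, p a • q = q a • p := fun a => by
      ext b
      have := hcon a b
      simp only [Pi.smul_apply, smul_eq_mul]
      linarith
    have h1 := hqe (e.symm (rankOne (Pi.single i 1)))
    have h2 := hpe (e.symm (rankOne (Pi.single i 1)))
    simp only [e.apply_symm_apply, evalForm_rankOne, single_one_dotProduct, Pi.single_eq_same,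
      Pi.single_eq_of_ne hij, mul_zero, mul_one] at h1 h2
    have hp0 : p = 0 := by
      ext a
      have h3 := congrArg (fun u => evalForm u u (e.symm (rankOne (Pi.single i 1)))) (hpq a)
      simp only [evalForm_smul_left, evalForm_smul_right, ← h1, ← h2] at h3
      simpa using h3
    have h4 := hpe (e.symm (rankOne (Pi.single j 1)))
    rw [hp0] at h4
    simp [evalForm_rankOne, evalForm_apply (0 : Fin n → ℝ)] at h4
  have hex : ∀ t : ℝ, ∃ y : Fin n → ℝ, 0 < t → (∀ k, 0 ≤ y k) ∧
      ∀ A, evalForm (Pi.single i 1 + t • Pi.single j 1) (Pi.single i 1 + t • Pi.single j 1) (e A) =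
        evalForm y y A := by
    intro t
    by_cases ht : 0 < t
    · have hs : ∀ k l : Fin n, 0 ≤ (Pi.single k 1 : Fin n → ℝ) l := fun k l => by
        rw [Pi.single_apply]; split_ifs <;> norm_num
      obtain ⟨y, hy, hye⟩ := exists_evalForm_comp_eq he
        (x := Pi.single i 1 + t • Pi.single j 1)
        (fun k => add_nonneg (hs i k) (mul_nonneg ht.le (hs j k))) (fun h0 => by
          have := congrFun h0 i
          simp [Pi.single_eq_of_ne hij] at this)
      exact ⟨y, fun _ => ⟨hy, hye⟩⟩
    · exact ⟨0, fun h => absurd h ht⟩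
  choose Y hY using hex
  have hexp : ∀ t, 0 < t → ∀ B, evalForm (Y t) (Y t) B = evalForm q q B +
      2 * t * evalForm (Pi.single i 1) (Pi.single j 1) (e B) + t ^ 2 * evalForm p p B := by
    intro t ht B
    rw [← (hY t ht).2 B, ← hqe, ← hpe]
    simp only [evalForm_add_left, evalForm_add_right, evalForm_smul_left, evalForm_smul_right,
      evalForm_comm (Pi.single j 1) (Pi.single i 1)]
    ring
  have hone : evalForm (Y 1) (Y 1) A = evalForm (q + p) (q + p) A := by
    rcases rankOne_pencil hq hp (fun t ht => (hY t ht).1)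
      -- The pencil is tested on `v wᵀ + w vᵀ`, whose factor 2 cancels that of the cross term.
      (m := fun v w => evalForm (Pi.single i 1) (Pi.single j 1) (e (symProd v w)))
      (fun t ht v w => by
        have := hexp t ht (symProd v w)
        simp only [evalForm_symProd] at this
        linarith) hab with h | h
    · rw [h]
    · rw [h, ← neg_one_smul ℝ (q + p), evalForm_smul_left, evalForm_smul_right]
      ring
  have h1 := hexp 1 one_pos A
  rw [hone] at h1
  simp only [evalForm_add_left, evalForm_add_right, evalForm_comm p q] at h1
  linarith

lemma exists_nonneg_conj {e : SymMat n ≃ₗ[ℝ] SymMat n} (he : ∀ A, e A ∈ SCOP n ↔ A ∈ SCOP n) :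
    ∃ Q : Matrix (Fin n) (Fin n) ℝ, IsNonnegMatrix Q ∧
      ∀ A : SymMat n, (e A : Matrix (Fin n) (Fin n) ℝ) = Q * (A : Matrix (Fin n) (Fin n) ℝ) * Qᵀ := by
  have hex : ∀ i : Fin n, ∃ y : Fin n → ℝ, (∀ k, 0 ≤ y k) ∧
      ∀ A, evalForm (Pi.single i 1) (Pi.single i 1) (e A) = evalForm y y A := fun i =>
    exists_evalForm_comp_eq he
      (fun l => by rw [Pi.single_apply]; split_ifs <;> norm_num) (by simp)
  choose Q hQ hQe using hex
  refine ⟨Matrix.of Q, hQ, fun A => ?_⟩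
  ext i j
  have hij : evalForm (Pi.single i 1) (Pi.single j 1) (e A) = evalForm (Q i) (Q j) A := by
    by_cases h : i = j
    · subst h; exact hQe i A
    · exact evalForm_single_eq he h (hQ i) (hQ j) (hQe i) (hQe j) A
  rw [evalForm_single] at hij
  rw [hij, Matrix.mul_assoc, Matrix.mul_apply]
  rfl

/-- Testing on `eₖ eₖᵀ` determines the squares of the entries of column `k`; nonnegativity fixes the
sign. -/
lemma eq_one_of_conj_eq_self {P : Matrix (Fin n) (Fin n) ℝ} (hP : IsNonnegMatrix P)
    (h : ∀ A : SymMat n, P * (A : Matrix (Fin n) (Fin n) ℝ) * Pᵀ = A) : P = 1 := by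
  ext i k
  have hval : ∀ a, P a k * P a k = (1 : Matrix (Fin n) (Fin n) ℝ) a k := fun a => by
    have h1 := congrFun (congrFun (h (rankOne (Pi.single k 1))) a) a
    have h2 : (rankOne (Pi.single k 1) : SymMat n) = Matrix.vecMulVec (Pi.single k (1 : ℝ))
      (Pi.single k 1) := rfl
    rw [h2, Matrix.mul_vecMulVec, Matrix.vecMulVec_mul, Matrix.vecMulVec_apply,
      Matrix.vecMulVec_apply, Matrix.vecMul_transpose, Matrix.mulVec_single_one] at h1
    rw [Matrix.col_apply] at h1
    rw [h1, Matrix.one_apply]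
    simp [Pi.single_apply]
  have h1 := hval i
  by_cases hik : i = k
  · subst hik
    rw [Matrix.one_apply_eq] at h1 ⊢
    rcases mul_self_eq_one_iff.1 h1 with h2 | h2
    · exact h2
    · linarith [hP i i]
  · rw [Matrix.one_apply_ne hik] at h1 ⊢
    exact mul_self_eq_zero.1 h1

lemma mul_nonneg_matrix {Q R : Matrix (Fin n) (Fin n) ℝ} (hQ : IsNonnegMatrix Q)
    (hR : IsNonnegMatrix R) : IsNonnegMatrix (Q * R) := fun i j => by
  rw [Matrix.mul_apply]
  exact Finset.sum_nonneg fun k _ => mul_nonneg (hQ i k) (hR k j)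

/-- Each row of an invertible nonnegative matrix with nonnegative inverse has exactly one
nonzero entry. -/
lemma existsUnique_ne_zero_row {Q R : Matrix (Fin n) (Fin n) ℝ} (hQ : IsNonnegMatrix Q)
    (hR : IsNonnegMatrix R) (hQR : Q * R = 1) (i : Fin n) : ∃! j, Q i j ≠ 0 := by
  have hRQ : R * Q = 1 := mul_eq_one_comm.1 hQR
  have hzero : ∀ {S T : Matrix (Fin n) (Fin n) ℝ}, IsNonnegMatrix S → IsNonnegMatrix T →
      S * T = 1 → ∀ a b c, a ≠ c → S a b ≠ 0 → T b c = 0 := by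
    intro S T hS hT hST a b c hac hne
    have h1 : ∑ k, S a k * T k c = 0 := by
      rw [← Matrix.mul_apply, hST, Matrix.one_apply_ne hac]
    have h2 := (Finset.sum_eq_zero_iff_of_nonneg
      fun k _ => mul_nonneg (hS a k) (hT k c)).1 h1 b (Finset.mem_univ b)
    exact (mul_eq_zero.1 h2).resolve_left hne
  have hrow : ∀ {S T : Matrix (Fin n) (Fin n) ℝ}, S * T = 1 → ∀ a, ∃ b, S a b * T b a ≠ 0 := by
    intro S T hST a
    by_contra! hcon
    have h1 : ∑ k, S a k * T k a = 1 := by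
      rw [← Matrix.mul_apply, hST, Matrix.one_apply_eq]
    simp [hcon] at h1
  obtain ⟨j, hj⟩ := hrow hQR i
  refine ⟨j, left_ne_zero_of_mul hj, fun k hk => ?_⟩
  by_contra hkj
  exact hk (hzero hR hQ hRQ j i k (Ne.symm hkj) (right_ne_zero_of_mul hj))

lemma isMonomialMatrix_of_mul_eq_one {Q R : Matrix (Fin n) (Fin n) ℝ} (hQ : IsNonnegMatrix Q)
    (hR : IsNonnegMatrix R) (hQR : Q * R = 1) : IsMonomialMatrix Q := by
  refine ⟨existsUnique_ne_zero_row hQ hR hQR, fun j => ?_⟩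
  have hT : Qᵀ * Rᵀ = 1 := by
    rw [← Matrix.transpose_mul, mul_eq_one_comm.1 hQR, Matrix.transpose_one]
  exact existsUnique_ne_zero_row (Q := Qᵀ) (R := Rᵀ) (fun a b => hQ b a) (fun a b => hR b a) hT j

lemma exists_nonneg_inverse {Q : Matrix (Fin n) (Fin n) ℝ} (hQ : IsMonomialMatrix Q)
    (hQ0 : IsNonnegMatrix Q) : ∃ R, IsNonnegMatrix R ∧ Q * R = 1 := by
  -- Transposed entrywise reciprocals; the convention `0⁻¹ = 0` keeps the zero pattern.
  refine ⟨Matrix.of fun j i => (Q i j)⁻¹, fun j i => inv_nonneg.2 (hQ0 i j), ?_⟩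
  ext i k
  rw [Matrix.mul_apply]
  obtain ⟨j, hj, hju⟩ := hQ.1 i
  have hz : ∀ l, l ≠ j → Q i l = 0 := fun l hl => by
    by_contra h
    exact hl (hju l h)
  rw [Finset.sum_eq_single j (fun l _ hl => by rw [hz l hl, zero_mul]) (by simp), Matrix.of_apply]
  by_cases hik : i = k
  · subst hik
    rw [mul_inv_cancel₀ hj, Matrix.one_apply_eq]
  · have : Q k j = 0 := by
      by_contra h
      exact hik ((hQ.2 j).unique hj h)
    rw [this, inv_zero, mul_zero, Matrix.one_apply_ne hik]

lemma conj_mem_SCOP {Q R : Matrix (Fin n) (Fin n) ℝ} (hQ : IsNonnegMatrix Q) (hQR : Q * R = 1)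
    {A B : SymMat n} (hA : A ∈ SCOP n)
    (hB : (B : Matrix (Fin n) (Fin n) ℝ) = Q * (A : Matrix (Fin n) (Fin n) ℝ) * Qᵀ) :
    B ∈ SCOP n := by
  intro x hx hx0
  rw [hB, dotProduct_conj_mulVec]
  refine hA _ (transpose_mulVec_nonneg hQ hx) fun h => hx0 ?_
  have h1 : Rᵀ *ᵥ (Qᵀ *ᵥ x) = x := by
    rw [Matrix.mulVec_mulVec, ← Matrix.transpose_mul, hQR, Matrix.transpose_one, Matrix.one_mulVec]
  rw [← h1, h, Matrix.mulVec_zero]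

end preservers

theorem mainTheorem3 (n : ℕ) (hn : 1 ≤ n) (L : SymMat n →ₗ[ℝ] SymMat n) :
    L '' SCOP n = SCOP n ↔
      ∃ Q : Matrix (Fin n) (Fin n) ℝ, IsMonomialMatrix Q ∧ IsNonnegMatrix Q ∧
        ∀ A : SymMat n,
          (L A : Matrix (Fin n) (Fin n) ℝ) = Q * (A : Matrix (Fin n) (Fin n) ℝ) * Qᵀ := by
  constructor
  · intro hL
    have hsurj : Function.Surjective L := by
      rw [← LinearMap.range_eq_top, eq_top_iff, ← span_SCOP, Submodule.span_le]
      intro B hB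
      rw [← hL] at hB
      obtain ⟨A, _, rfl⟩ := hB
      exact ⟨A, rfl⟩
    have hinj : Function.Injective L := LinearMap.injective_iff_surjective.2 hsurj
    let e : SymMat n ≃ₗ[ℝ] SymMat n := LinearEquiv.ofBijective L ⟨hinj, hsurj⟩
    have heL : ∀ A, e A = L A := fun A => rfl
    have he : ∀ A, e A ∈ SCOP n ↔ A ∈ SCOP n := fun A => by
      rw [heL]
      conv_lhs => rw [← hL]
      exact hinj.mem_set_image
    have he' : ∀ A, e.symm A ∈ SCOP n ↔ A ∈ SCOP n := fun A => by
      rw [← he, e.apply_symm_apply]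
    obtain ⟨Q, hQ, hQe⟩ := exists_nonneg_conj he
    obtain ⟨R, hR, hRe⟩ := exists_nonneg_conj he'
    have hQR : Q * R = 1 := eq_one_of_conj_eq_self (mul_nonneg_matrix hQ hR) fun A => by
      have h1 := hQe (e.symm A)
      rw [e.apply_symm_apply, hRe] at h1
      conv_rhs => rw [h1]
      rw [Matrix.transpose_mul]
      simp only [Matrix.mul_assoc]
    exact ⟨Q, isMonomialMatrix_of_mul_eq_one hQ hR hQR, hQ, hQe⟩
  · rintro ⟨Q, hQm, hQ, hLQ⟩
    obtain ⟨R, hR, hQR⟩ := exists_nonneg_inverse hQm hQ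
    refine Set.Subset.antisymm ?_ fun B hB => ?_
    · rintro _ ⟨A, hA, rfl⟩
      exact conj_mem_SCOP hQ hQR hA (hLQ A)
    · have hsymm : (R * (B : Matrix (Fin n) (Fin n) ℝ) * Rᵀ).IsSymm := by
        have hB' : (B : Matrix (Fin n) (Fin n) ℝ)ᵀ = B := B.2
        rw [Matrix.IsSymm, Matrix.transpose_mul, Matrix.transpose_mul, Matrix.transpose_transpose,
          hB', Matrix.mul_assoc]
      refine ⟨⟨_, hsymm⟩, conj_mem_SCOP hR (mul_eq_one_comm.1 hQR) hB rfl, ?_⟩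
      apply Subtype.ext
      rw [hLQ]
      change Q * (R * (B : Matrix (Fin n) (Fin n) ℝ) * Rᵀ) * Qᵀ = B
      calc Q * (R * (B : Matrix (Fin n) (Fin n) ℝ) * Rᵀ) * Qᵀ
          = (Q * R) * (B : Matrix (Fin n) (Fin n) ℝ) * (Q * R)ᵀ := by
            rw [Matrix.transpose_mul]
            simp only [Matrix.mul_assoc]
        _ = B := by rw [hQR, Matrix.transpose_one, Matrix.one_mul, Matrix.mul_one]
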